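/- **Corollary 1 (NSP of biased subgaussian matrices).** For $x\in\mathbb{R}^N$ and real $q\ge 1$ let $\|x\|_q=(\sum_i|x_i|^q)^{1/q}$. For $v\in\mathbb{R}^n$ and $S\subset\{1,\dots,n\}$ let $v_S$ be the vector that agrees with $v$ on $S$ and is zero off $S$, and let $S^C$ be the complement of $S$. A matrix $A\in\mathbb{R}^{m\times n}$ has the $\ell_q$-robust null space property ($\ell_q$-NSP) of order $s$ with respect to the $\ell_2$-norm, with parameters $\rho\in(0,1)$ and $\tau>0$, if for all $v\in\mathbb{R}^n$ and all $S\subset\{1,\dots,n\}$ with $|S|\le s$ $$\|v_S\|_q\le\frac{\rho}{s^{1-1/q}}\|v_{S^C}\|_1+\tau\|Av\|_2 .$$ Let $m,n,s$ be natural numbers with $1\le s\le n$, let $q\in[2,\infty)$ and $\rho\in(0,1)$, and suppose that $$m\ \ge\ \frac{2\cdot 384^2}{\rho^2}\,s^{2-2/q}\left(2+\sqrt{\log\left(\frac{en}{s}\right)}\right)^2+1 .$$ Then there is $\tau>0$, depending only on $m,n,s,q,\rho$, such that the following holds. Let $a_0$ be a random vector in $\mathbb{R}^n$ that is * sub-isotropic: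 $\mathbb{E}\,\langle a_0,v\rangle^2\ge\|v\|_2^2$ for all $v\in\mathbb{R}^n$, and * $1$-subgaussian: $\mathbb{E}\exp(t\langle a_0,v\rangle)\le\exp(t^2)$ for all $v\in\mathbb{R}^n$ with $\|v\|_2^2\le 1$ and all $t\in\mathbb{R}$, let $a_{0,1},\dots,a_{0,m}$ be independent copies of $a_0$, let $\mu\in\mathbb{R}$, and let $A\in\mathbb{R}^{m\times n}$ be the random matrix with rows $a_i=a_{0,i}+\mu\mathbf{1}$, where $\mathbf{1}=(1,\dots,1)$. Then with probability at least $1-e^{-(m-1)/64}$ the matrix $A$ has the $\ell_q$-NSP of order $s$ with parameters $\rho$ and $\tau$. In particular, neither the condition on $m$ nor $\tau$ depends on the bias $\mu$. -/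

import Mathlib

open MeasureTheory ProbabilityTheory

/-- The `ℓ_q` norm `(∑ |x_i|^q)^(1/q)` of a finite real vector, for a real exponent `q ≥ 1`. -/
noncomputable def lqNorm {ι : Type*} [Fintype ι] (q : ℝ) (x : ι → ℝ) : ℝ :=
  (∑ i, |x i| ^ q) ^ (1 / q)

/-- The `ℓ_q`-robust null space property of order `s` with respect to the `ℓ_2` norm, with
parameters `ρ` and `τ`. The vector `v_S` agrees with `v` on `S` and vanishes off `S`. -/
def RobustNSP {m n : ℕ} (q : ℝ) (s : ℕ) (ρ τ : ℝ) (A : Matrix (Fin m) (Fin n) ℝ) : Prop :=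
  ∀ (v : Fin n → ℝ) (S : Finset (Fin n)), S.card ≤ s →
    lqNorm q (Set.indicator (S : Set (Fin n)) v) ≤
      ρ / (s : ℝ) ^ (1 - 1 / q) * lqNorm 1 (Set.indicator (S : Set (Fin n))ᶜ v)
        + τ * lqNorm 2 (A.mulVec v)

/-- Sub-isotropy of a random vector: `E ⟨X, v⟩² ≥ ‖v‖²` for all `v`. -/
def SubIsotropic {Ω : Type*} [MeasurableSpace Ω] {n : ℕ}
    (X : Ω → EuclideanSpace ℝ (Fin n)) (P : Measure Ω) : Prop :=
  ∀ v : EuclideanSpace ℝ (Fin n),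
    Integrable (fun ω => inner ℝ (X ω) v ^ 2) P ∧ ‖v‖ ^ 2 ≤ ∫ ω, inner ℝ (X ω) v ^ 2 ∂P

/-- A `1`-subgaussian random vector: `E exp (t ⟨X, v⟩) ≤ exp (t²)`, the expectation being finite,
for all `v` in the Euclidean unit ball and all real `t`. -/
def OneSubgaussian {Ω : Type*} [MeasurableSpace Ω] {n : ℕ}
    (X : Ω → EuclideanSpace ℝ (Fin n)) (P : Measure Ω) : Prop :=
  ∀ v : EuclideanSpace ℝ (Fin n), ‖v‖ ^ 2 ≤ 1 → ∀ t : ℝ,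
    Integrable (fun ω => Real.exp (t * inner ℝ (X ω) v)) P ∧
      ∫ ω, Real.exp (t * inner ℝ (X ω) v) ∂P ≤ Real.exp (t ^ 2)

/-- The matrix whose `i`-th row is `a i + μ 1`. -/
def biasedMatrix {m n : ℕ} (a : Fin m → EuclideanSpace ℝ (Fin n)) (μ : ℝ) :
    Matrix (Fin m) (Fin n) ℝ :=
  Matrix.of fun i j => a i j + μ

/-!
The normalized differences of disjoint pairs of rows are again independent, sub-isotropic and
`1`-subgaussian, they do not see the bias, and passing to them does not increase the norm of the
image of a vector. A vector can violate the null space property only if it lies in the cone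
`‖v‖₁ ≤ 2 L ‖v‖₂` with `L = s ^ (1 - 1 / q) / ρ`, so a lower bound for the matrix of differences on
this cone suffices. By Maurey's empirical method such a bound follows from lower bounds at the
finitely many sums of about `L ^ 2` signed basis vectors, together with upper bounds at the basis
vectors. Each of these fails with exponentially small probability, by Chernoff bounds for the
squares of subgaussian variables, and the union bound applies since there are only
`exp (O (L ^ 2 log (e n / s)))` of them.
-/

section Maurey

variable {ι E F : Type*} [Fintype ι] [NormedAddCommGroup F] [InnerProductSpace ℝ F]

theorem exists_le_sum_mul_of_mem_stdSimplex {p : ι → ℝ} (hp : p ∈ stdSimplex ℝ ι) (f : ι → ℝ) :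
    ∃ i, f i ≤ ∑ j, p j * f j := by
  have hle := Finset.inf_le_centerMass (f := f) (fun i _ ↦ hp.1 i) (hp.2 ▸ one_pos)
  obtain ⟨i, -, hi⟩ := Finset.exists_mem_eq_inf' (Finset.nonempty_of_sum_ne_zero
    (hp.2 ▸ one_ne_zero)) f
  refine ⟨i, ?_⟩
  rwa [Finset.centerMass_eq_of_sum_1 _ _ hp.2, hi] at hle

theorem sum_mul_norm_add_sub_sq {p : ι → ℝ} (hp : ∑ i, p i = 1) (x : ι → F) (z : F) :
    ∑ i, p i * ‖z + (x i - ∑ j, p j • x j)‖ ^ 2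
      = ‖z‖ ^ 2 + ∑ i, p i * ‖x i‖ ^ 2 - ‖∑ j, p j • x j‖ ^ 2 := by
  set w := ∑ j, p j • x j with hw
  have expand (i : ι) : p i * ‖z + (x i - w)‖ ^ 2
      = p i * ‖z - w‖ ^ 2 + 2 * inner ℝ (z - w) (p i • x i) + p i * ‖x i‖ ^ 2 := by
    rw [show z + (x i - w) = (z - w) + x i by abel, norm_add_sq_real, inner_smul_right]
    ring
  simp_rw [expand, Finset.sum_add_distrib, ← Finset.sum_mul, hp, ← Finset.mul_sum, ← inner_sum,
    ← hw, norm_sub_sq_real, inner_sub_left, real_inner_self_eq_norm_sq]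
  ring

/-- The sum `∑_{i ∈ σ} f i` over a multiset `σ` of size `k`. Divided by `k`, these sums are the
empirical means used to approximate convex combinations of the `f i`. -/
def symSum [AddCommMonoid E] {k : ℕ} (f : ι → E) (σ : Sym ι k) : E :=
  ((σ : Multiset ι).map f).sum

-- Maurey's empirical method, derandomized: the points are chosen one at a time.
theorem exists_norm_map_symSum_sub_sq_le [AddCommGroup E] [Module ℝ E] (Φ : E →ₗ[ℝ] F)
    {p : ι → ℝ} (hp : p ∈ stdSimplex ℝ ι) (f : ι → E) {B : ℝ} (hB : ∀ i, ‖Φ (f i)‖ ^ 2 ≤ B)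
    (k : ℕ) : ∃ σ : Sym ι k, ‖Φ (symSum f σ - (k : ℝ) • ∑ i, p i • f i)‖ ^ 2 ≤ k * B := by
  induction k with
  | zero => exact ⟨Sym.nil, by simp [symSum]⟩
  | succ k ih =>
    obtain ⟨σ, hσ⟩ := ih
    set z := Φ (symSum f σ - (k : ℝ) • ∑ i, p i • f i)
    obtain ⟨i, hi⟩ := exists_le_sum_mul_of_mem_stdSimplex hp
      fun i ↦ ‖z + (Φ (f i) - ∑ j, p j • Φ (f j))‖ ^ 2
    refine ⟨i ::ₛ σ, ?_⟩
    have step : Φ (symSum f (i ::ₛ σ) - ((k + 1 : ℕ) : ℝ) • ∑ i, p i • f i)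
        = z + (Φ (f i) - ∑ j, p j • Φ (f j)) := by
      simp only [z, symSum, Sym.coe_cons, Multiset.map_cons, Multiset.sum_cons, map_sub, map_add,
        map_smul, map_sum, Nat.cast_add, Nat.cast_one, add_smul, one_smul]
      abel
    have mean_le : ∑ j, p j * ‖Φ (f j)‖ ^ 2 ≤ B := by
      calc ∑ j, p j * ‖Φ (f j)‖ ^ 2 ≤ ∑ j, p j * B :=
            Finset.sum_le_sum fun j _ ↦ mul_le_mul_of_nonneg_left (hB j) (hp.1 j)
        _ = B := by rw [← Finset.sum_mul, hp.2, one_mul]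
    rw [sum_mul_norm_add_sub_sq hp.2] at hi
    rw [step]
    push_cast
    linarith [sq_nonneg ‖∑ j, p j • Φ (f j)‖]

theorem card_sym_le_exp [DecidableEq ι] {k : ℕ} (hk : 0 < k) :
    (Fintype.card (Sym ι k) : ℝ)
      ≤ Real.exp (k * (1 + Real.log ((Fintype.card ι + k) / k))) := by
  set N := Fintype.card ι
  have hpos : (0 : ℝ) < (N + k) / k := by positivity
  calc (Fintype.card (Sym ι k) : ℝ) ≤ ((N + k - 1 : ℕ) : ℝ) ^ k / k.factorial := by
        rw [Sym.card_sym_eq_choose]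
        exact Nat.choose_le_pow_div k _
    _ ≤ (N + k : ℝ) ^ k / k.factorial := by
        gcongr
        exact_mod_cast Nat.sub_le _ _
    _ = (k : ℝ) ^ k / k.factorial * ((N + k) / k) ^ k := by
        rw [div_pow]
        field_simp
    _ ≤ Real.exp k * ((N + k) / k) ^ k := by
        gcongr
        exact Real.pow_div_factorial_le_exp _ k.cast_nonneg k
    _ = Real.exp (k * (1 + Real.log ((N + k) / k))) := by
        rw [mul_add, mul_one, Real.exp_add, Real.exp_nat_mul, Real.exp_log hpos]

end Maurey

section RestrictedLowerBound

variable {ι E F : Type*} [NormedAddCommGroup E] [InnerProductSpace ℝ E]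
  [NormedAddCommGroup F] [InnerProductSpace ℝ F]

/-- The family `e_1, …, e_n, -e_1, …, -e_n` of signed standard basis vectors, the extreme points of
the `ℓ_1` unit ball; the two copies of `ι` carry the two signs. -/
noncomputable def signedBasis [DecidableEq ι] : ι ⊕ ι → EuclideanSpace ℝ ι :=
  Sum.elim (fun i ↦ EuclideanSpace.single i 1) (fun i ↦ -EuclideanSpace.single i 1)

theorem exists_mem_stdSimplex_sum_smul_signedBasis [DecidableEq ι] [Fintype ι]
    {v : EuclideanSpace ℝ ι} (hv : ∑ i, |v i| = 1) :
    ∃ p ∈ stdSimplex ℝ (ι ⊕ ι), ∑ i, p i • signedBasis i = v := by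
  refine ⟨Sum.elim (fun i ↦ (v i)⁺) fun i ↦ (v i)⁻, ⟨?_, ?_⟩, ?_⟩
  · rintro (i | i)
    exacts [posPart_nonneg _, negPart_nonneg _]
  · simp only [Fintype.sum_sum_type, Sum.elim_inl, Sum.elim_inr, ← Finset.sum_add_distrib,
      posPart_add_negPart, hv]
  · simp only [Fintype.sum_sum_type, signedBasis, Sum.elim_inl, Sum.elim_inr, smul_neg,
      ← Finset.sum_add_distrib, ← sub_eq_add_neg, ← sub_smul, posPart_sub_negPart]
    ext j
    simp [Finset.sum_apply, Pi.single_apply]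

theorem exists_linearMap_norm_sq_eq (T : E →ₗ[ℝ] F) (α : ℝ) :
    ∃ Φ : E →ₗ[ℝ] WithLp 2 (E × F), ∀ x, ‖Φ x‖ ^ 2 = α ^ 2 * ‖x‖ ^ 2 + ‖T x‖ ^ 2 := by
  refine ⟨(WithLp.linearEquiv 2 ℝ (E × F)).symm.toLinearMap ∘ₗ
    LinearMap.prod (α • LinearMap.id) T, fun x ↦ ?_⟩
  rw [WithLp.prod_norm_sq_eq_of_L2]
  simp [norm_smul, mul_pow]

variable [DecidableEq ι] {T : EuclideanSpace ℝ ι →ₗ[ℝ] F} {α β : ℝ} {k : ℕ}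

theorem norm_map_signedBasis (i : ι ⊕ ι) :
    ‖T (signedBasis i)‖ = ‖T (EuclideanSpace.single (i.elim id id) 1)‖ := by
  rcases i with i | i <;> simp [signedBasis]

variable [Fintype ι]

theorem le_norm_map_add_of_sum_abs_eq_one (hk : 0 < k) (hα : 0 ≤ α)
    (hcol : ∀ i, ‖T (EuclideanSpace.single i 1)‖ ^ 2 ≤ β)
    (hnet : ∀ σ : Sym (ι ⊕ ι) k, α * ‖symSum signedBasis σ‖ ≤ ‖T (symSum signedBasis σ)‖)
    {v : EuclideanSpace ℝ ι} (hv : ∑ i, |v i| = 1) :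
    α * ‖v‖ ≤ ‖T v‖ + √(2 * (α ^ 2 + β) / k) := by
  have hk' : (0 : ℝ) < k := mod_cast hk
  obtain ⟨p, hp, hpv⟩ := exists_mem_stdSimplex_sum_smul_signedBasis hv
  obtain ⟨Φ, hΦ⟩ := exists_linearMap_norm_sq_eq T α
  have hΦ_basis (i : ι ⊕ ι) : ‖Φ (signedBasis i)‖ ^ 2 ≤ α ^ 2 + β := by
    have norm_basis : ‖(signedBasis i : EuclideanSpace ℝ ι)‖ = 1 := by
      rcases i with i | i <;> simp [signedBasis]
    rw [hΦ, norm_map_signedBasis, norm_basis, one_pow, mul_one]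
    exact add_le_add_right (hcol _) _
  obtain ⟨σ, hσ⟩ := exists_norm_map_symSum_sub_sq_le Φ hp signedBasis hΦ_basis k
  set y : EuclideanSpace ℝ ι := symSum signedBasis σ
  rw [hpv, hΦ] at hσ
  set x := y - (k : ℝ) • v with hx
  have error_le : α * ‖x‖ + ‖T x‖ ≤ k * √(2 * (α ^ 2 + β) / k) := by
    have hβ : k * √(2 * (α ^ 2 + β) / k) = √(2 * (k * (α ^ 2 + β))) := by
      rw [← Real.sqrt_sq hk'.le, ← Real.sqrt_mul (sq_nonneg _), Real.sqrt_sq hk'.le]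
      congr 1
      field_simp
    rw [hβ]
    refine Real.le_sqrt_of_sq_le ?_
    linarith [add_sq_le (a := α * ‖x‖) (b := ‖T x‖), mul_pow α ‖x‖ 2]
  have upper : ‖T y‖ ≤ k * ‖T v‖ + ‖T x‖ := by
    calc ‖T y‖ = ‖(k : ℝ) • T v + T x‖ := by rw [← map_smul, ← map_add, hx, add_sub_cancel]
      _ ≤ k * ‖T v‖ + ‖T x‖ := (norm_add_le _ _).trans_eq (by simp [norm_smul])
  have lower : k * ‖v‖ ≤ ‖y‖ + ‖x‖ := by
    calc k * ‖v‖ = ‖y - x‖ := by simp [hx, norm_smul]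
      _ ≤ ‖y‖ + ‖x‖ := norm_sub_le _ _
  refine le_of_mul_le_mul_left ?_ hk'
  linarith [hnet σ, mul_le_mul_of_nonneg_left lower hα]

theorem le_norm_map_add_of_forall_sym (hk : 0 < k) (hα : 0 ≤ α)
    (hcol : ∀ i, ‖T (EuclideanSpace.single i 1)‖ ^ 2 ≤ β)
    (hnet : ∀ σ : Sym (ι ⊕ ι) k, α * ‖symSum signedBasis σ‖ ≤ ‖T (symSum signedBasis σ)‖)
    (v : EuclideanSpace ℝ ι) :
    α * ‖v‖ ≤ ‖T v‖ + √(2 * (α ^ 2 + β) / k) * ∑ i, |v i| := by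
  rcases eq_or_ne v 0 with rfl | hv
  · simp
  set r := ∑ i, |v i| with hr
  have hr0 : 0 < r := by
    obtain ⟨i, hi⟩ : ∃ i, v i ≠ 0 := by simpa [PiLp.ext_iff] using hv
    exact Finset.sum_pos' (fun _ _ ↦ abs_nonneg _) ⟨i, Finset.mem_univ i, abs_pos.2 hi⟩
  have h := le_norm_map_add_of_sum_abs_eq_one hk hα hcol hnet (v := r⁻¹ • v) (by
    simp [abs_mul, ← Finset.mul_sum, ← hr, abs_of_pos hr0, hr0.ne'])
  rw [map_smul, norm_smul, norm_smul, Real.norm_of_nonneg (inv_pos.2 hr0).le] at h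
  refine le_of_mul_le_mul_left ?_ (inv_pos.2 hr0)
  calc r⁻¹ * (α * ‖v‖) = α * (r⁻¹ * ‖v‖) := by ring
    _ ≤ r⁻¹ * ‖T v‖ + √(2 * (α ^ 2 + β) / k) := h
    _ = r⁻¹ * (‖T v‖ + √(2 * (α ^ 2 + β) / k) * r) := by field_simp

end RestrictedLowerBound

section SubgaussianSquare

variable {Ω : Type*} [MeasurableSpace Ω] {P : Measure Ω} {X : Ω → ℝ} {c : NNReal}

theorem integral_eq_zero_of_hasSubgaussianMGF [IsProbabilityMeasure P]
    (h : HasSubgaussianMGF X c P) : ∫ ω, X ω ∂P = 0 := by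
  have hmgf : HasDerivAt (mgf X P) (∫ ω, X ω ∂P) 0 := by
    simpa using hasDerivAt_mgf (X := X) (μ := P) (t := 0) (by simp [h.integrableExpSet_eq_univ])
  have hexp : HasDerivAt (fun t : ℝ ↦ Real.exp (c * t ^ 2 / 2)) 0 0 := by
    simpa using ((((hasDerivAt_id (0 : ℝ)).pow 2).const_mul (c : ℝ)).div_const 2).exp
  have hmax : IsLocalMax (mgf X P - fun t ↦ Real.exp (c * t ^ 2 / 2)) 0 :=
    .of_forall fun t ↦ by simpa using h.mgf_le t
  simpa using hmax.hasDerivAt_eq_zero (hmgf.sub hexp)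

theorem integrable_cosh_mul_of_hasSubgaussianMGF (h : HasSubgaussianMGF X c P) (t : ℝ) :
    Integrable (fun ω ↦ Real.cosh (t * X ω)) P := by
  simp_rw [Real.cosh_eq, ← neg_mul]
  exact ((h.integrable_exp_mul t).add (h.integrable_exp_mul (-t))).div_const 2

theorem integral_cosh_mul_le_of_hasSubgaussianMGF (h : HasSubgaussianMGF X c P) (t : ℝ) :
    ∫ ω, Real.cosh (t * X ω) ∂P ≤ Real.exp (c * t ^ 2 / 2) := by
  have eq_mgf : ∫ ω, Real.cosh (t * X ω) ∂P = (mgf X P t + mgf X P (-t)) / 2 := by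
    simp_rw [Real.cosh_eq, ← neg_mul]
    rw [integral_div, integral_add (h.integrable_exp_mul t) (h.integrable_exp_mul (-t)), mgf, mgf]
  have h_neg := h.mgf_le (-t)
  rw [neg_sq] at h_neg
  linarith [h.mgf_le t]

theorem one_add_sq_add_pow_four_add_pow_six_le_cosh (x : ℝ) :
    1 + x ^ 2 + x ^ 4 / 6 + x ^ 6 / 90 ≤ Real.cosh (√2 * x) := by
  have h := sum_le_hasSum (Finset.range 4) (fun i _ ↦ by
    rw [pow_mul]
    positivity) (Real.hasSum_cosh (√2 * x))
  refine le_of_eq_of_le ?_ h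
  simp only [Finset.sum_range_succ, Finset.sum_range_zero, pow_mul, mul_pow,
    Real.sq_sqrt (zero_le_two (α := ℝ)), Nat.factorial]
  push_cast
  ring

-- The coefficients are such that, for `y = X ^ 2` with `E X ^ 2 ≥ 1` and `E cosh (√2 X) ≤ e ^ 2`,
-- the expectation of the right-hand side is at most `1 - 1 / 20`.
theorem exp_neg_div_four_le {y : ℝ} (hy : 0 ≤ y) :
    Real.exp (-(y / 4)) ≤ 1 - 41 / 500 * y + 1 / 200 * (y + y ^ 2 / 6 + y ^ 3 / 90) := by
  calc Real.exp (-(y / 4)) ≤ 4 / (4 + y) := by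
        rw [Real.exp_neg, inv_le_comm₀ (Real.exp_pos _) (by positivity), inv_div]
        linarith [Real.add_one_le_exp (y / 4)]
    _ ≤ 1 - 41 / 500 * y + 1 / 200 * (y + y ^ 2 / 6 + y ^ 3 / 90) := by
        rw [div_le_iff₀ (by positivity)]
        nlinarith [mul_nonneg hy (sq_nonneg (y - 16)),
          mul_nonneg (mul_nonneg hy hy) (sq_nonneg (y - 16))]

theorem exp_neg_sq_div_four_le (x : ℝ) :
    Real.exp (-(x ^ 2 / 4)) ≤ 1 - 41 / 500 * x ^ 2 + 1 / 200 * (Real.cosh (√2 * x) - 1) := by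
  refine (exp_neg_div_four_le (sq_nonneg x)).trans ?_
  rw [← pow_mul, ← pow_mul]
  linarith [one_add_sq_add_pow_four_add_pow_six_le_cosh x]

theorem mgf_sq_neg_le_of_hasSubgaussianMGF [IsProbabilityMeasure P] (h : HasSubgaussianMGF X 2 P)
    (hX : 1 ≤ ∫ ω, X ω ^ 2 ∂P) : mgf (fun ω ↦ X ω ^ 2) P (-(1 / 4)) ≤ Real.exp (-(1 / 20)) := by
  have int_sq : Integrable (fun ω ↦ X ω ^ 2) P := (h.memLp 2).integrable_sq
  have int_cosh := integrable_cosh_mul_of_hasSubgaussianMGF h √2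
  have int_affine : Integrable (fun ω ↦ 1 - 41 / 500 * X ω ^ 2) P :=
    (integrable_const 1).sub (int_sq.const_mul _)
  have int_remainder : Integrable (fun ω ↦ 1 / 200 * (Real.cosh (√2 * X ω) - 1)) P :=
    (int_cosh.sub (integrable_const 1)).const_mul _
  have cosh_le : ∫ ω, Real.cosh (√2 * X ω) ∂P ≤ 7.39 := by
    refine (integral_cosh_mul_le_of_hasSubgaussianMGF h √2).trans ?_
    rw [Real.sq_sqrt zero_le_two, NNReal.coe_ofNat, show (2 * 2 / 2 : ℝ) = (2 : ℕ) * 1 by norm_num,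
      Real.exp_nat_mul]
    nlinarith [Real.exp_one_lt_d9, Real.exp_pos 1]
  calc mgf (fun ω ↦ X ω ^ 2) P (-(1 / 4))
      ≤ ∫ ω, (1 - 41 / 500 * X ω ^ 2 + 1 / 200 * (Real.cosh (√2 * X ω) - 1)) ∂P := by
        refine integral_mono_of_nonneg (ae_of_all _ fun ω ↦ (Real.exp_pos _).le)
          (int_affine.add int_remainder) (ae_of_all _ fun ω ↦ ?_)
        exact (exp_neg_sq_div_four_le (X ω)).trans_eq' (by congr 1; ring)
    _ = 1 - 41 / 500 * ∫ ω, X ω ^ 2 ∂P + 1 / 200 * (∫ ω, Real.cosh (√2 * X ω) ∂P - 1) := by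
        rw [integral_add int_affine int_remainder,
          integral_sub (integrable_const 1) (int_sq.const_mul _), integral_const_mul,
          integral_const_mul, integral_sub int_cosh (integrable_const 1)]
        simp
    _ ≤ -(1 / 20) + 1 := by linarith
    _ ≤ Real.exp (-(1 / 20)) := Real.add_one_le_exp _

theorem lintegral_exp_mul_sq_gaussianReal {a : ℝ} (ha : a < 1) :
    ∫⁻ g, ENNReal.ofReal (Real.exp (a * g ^ 2 / 2)) ∂gaussianReal 0 1
      = ENNReal.ofReal (√(1 - a))⁻¹ := by
  have hb : 0 < (1 - a) / 2 := by linarith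
  have density (g : ℝ) : (gaussianPDF 0 1 * fun g ↦ ENNReal.ofReal (Real.exp (a * g ^ 2 / 2))) g
      = ENNReal.ofReal ((√(2 * Real.pi))⁻¹ * Real.exp (-((1 - a) / 2) * g ^ 2)) := by
    rw [Pi.mul_apply, gaussianPDF, ← ENNReal.ofReal_mul (gaussianPDFReal_nonneg _ _ _),
      gaussianPDFReal, mul_assoc, ← Real.exp_add, NNReal.coe_one, mul_one]
    congr 3
    ring
  rw [gaussianReal_of_var_ne_zero 0 one_ne_zero,
    lintegral_withDensity_eq_lintegral_mul _ (by fun_prop) (by fun_prop), lintegral_congr density,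
    ← ofReal_integral_eq_lintegral_ofReal ((integrable_exp_neg_mul_sq hb).const_mul _)
      (ae_of_all _ fun g ↦ by positivity),
    integral_const_mul, integral_gaussian, ← Real.sqrt_inv, ← Real.sqrt_inv,
    ← Real.sqrt_mul (by positivity)]
  congr 2
  field_simp

-- For a standard Gaussian `g`, `exp (t² x² / 2) = E exp (t g x)`; Tonelli then integrates out `X`
-- first, leaving the Gaussian integral of `exp (c t² g² / 2)`.
theorem lintegral_exp_sq_le_of_hasSubgaussianMGF [SFinite P] (h : HasSubgaussianMGF X c P) {t : ℝ}
    (ht : c * t ^ 2 < 1) :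
    ∫⁻ ω, ENNReal.ofReal (Real.exp (t ^ 2 / 2 * X ω ^ 2)) ∂P
      ≤ ENNReal.ofReal (√(1 - c * t ^ 2))⁻¹ := by
  have decouple (ω : Ω) : ENNReal.ofReal (Real.exp (t ^ 2 / 2 * X ω ^ 2))
      = ∫⁻ g, ENNReal.ofReal (Real.exp (t * g * X ω)) ∂gaussianReal 0 1 := by
    simp_rw [mul_right_comm t _ (X ω)]
    rw [← ofReal_integral_eq_lintegral_ofReal (integrable_exp_mul_gaussianReal _)
      (ae_of_all _ fun g ↦ (Real.exp_pos _).le)]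
    have hmgf := congrFun (mgf_fun_id_gaussianReal (μ := 0) (v := 1)) (t * X ω)
    rw [mgf] at hmgf
    rw [hmgf, NNReal.coe_one]
    ring_nf
  simp_rw [decouple]
  rw [lintegral_lintegral_swap]
  · rw [← lintegral_exp_mul_sq_gaussianReal ht]
    refine lintegral_mono fun g ↦ ?_
    rw [← ofReal_integral_eq_lintegral_ofReal (h.integrable_exp_mul (t * g))
      (ae_of_all _ fun ω ↦ (Real.exp_pos _).le)]
    refine ENNReal.ofReal_le_ofReal ((h.mgf_le (t * g)).trans_eq ?_)
    ring_nf
  · have hX : AEMeasurable (fun z : Ω × ℝ ↦ X z.1) (P.prod (gaussianReal 0 1)) :=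
      h.aemeasurable.comp_fst
    have hg : AEMeasurable (fun z : Ω × ℝ ↦ t * z.2) (P.prod (gaussianReal 0 1)) := by fun_prop
    exact (hg.mul hX).exp.ennreal_ofReal

theorem integrable_exp_sq_of_hasSubgaussianMGF [SFinite P] (h : HasSubgaussianMGF X c P) {t : ℝ}
    (ht : c * t ^ 2 < 1) : Integrable (fun ω ↦ Real.exp (t ^ 2 / 2 * X ω ^ 2)) P := by
  refine ⟨((h.aemeasurable.pow_const 2).const_mul _).exp.aestronglyMeasurable, ?_⟩
  rw [hasFiniteIntegral_iff_ofReal (ae_of_all _ fun ω ↦ (Real.exp_pos _).le)]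
  exact (lintegral_exp_sq_le_of_hasSubgaussianMGF h ht).trans_lt ENNReal.ofReal_lt_top

theorem mgf_sq_le_of_hasSubgaussianMGF [SFinite P] (h : HasSubgaussianMGF X c P) {t : ℝ}
    (ht : c * t ^ 2 < 1) : mgf (fun ω ↦ X ω ^ 2) P (t ^ 2 / 2) ≤ (√(1 - c * t ^ 2))⁻¹ := by
  rw [mgf, integral_eq_lintegral_of_nonneg_ae (ae_of_all _ fun ω ↦ (Real.exp_pos _).le)
    (integrable_exp_sq_of_hasSubgaussianMGF h ht).aestronglyMeasurable]
  exact ENNReal.toReal_le_of_le_ofReal (by positivity)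
    (lintegral_exp_sq_le_of_hasSubgaussianMGF h ht)

end SubgaussianSquare

section SumOfSquares

variable {Ω κ : Type*} [MeasurableSpace Ω] {P : Measure Ω} [Fintype κ] {X : κ → Ω → ℝ}

theorem mgf_sum_le_pow {C t : ℝ} (hind : iIndepFun X P) (hX : ∀ i, AEMeasurable (X i) P)
    (hC : ∀ i, mgf (X i) P t ≤ C) : mgf (∑ i, X i) P t ≤ C ^ Fintype.card κ := by
  rw [hind.mgf_sum₀ hX]
  exact (Finset.prod_le_prod (fun i _ ↦ mgf_nonneg) fun i _ ↦ hC i).trans_eq (by simp)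

theorem measureReal_sum_sq_le_le_exp (hind : iIndepFun X P)
    (hsub : ∀ i, HasSubgaussianMGF (X i) 2 P) (hX : ∀ i, 1 ≤ ∫ ω, X i ω ^ 2 ∂P) :
    P.real {ω | ∑ i, X i ω ^ 2 ≤ Fintype.card κ / 25} ≤ Real.exp (-(Fintype.card κ / 25)) := by
  have := hind.isProbabilityMeasure
  have hmeas (i : κ) : AEMeasurable (fun ω ↦ X i ω ^ 2) P := (hsub i).aemeasurable.pow_const 2
  have hmgf := mgf_sum_le_pow (hind.comp (fun _ x ↦ x ^ 2) fun _ ↦ by fun_prop) hmeas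
    fun i ↦ mgf_sq_neg_le_of_hasSubgaussianMGF (hsub i) (hX i)
  have hint : Integrable (fun ω ↦ Real.exp (-(1 / 4) * (∑ i, fun ω ↦ X i ω ^ 2) ω)) P := by
    refine .of_bound (C := 1) (by fun_prop) (ae_of_all _ fun ω ↦ ?_)
    rw [Real.norm_of_nonneg (Real.exp_pos _).le, Real.exp_le_one_iff, Finset.sum_apply]
    linarith [Finset.sum_nonneg fun i (_ : i ∈ Finset.univ) ↦ sq_nonneg (X i ω)]
  have chernoff := measure_le_le_exp_mul_mgf (μ := P) (Fintype.card κ / 25 : ℝ) (by norm_num) hint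
  simp only [Finset.sum_apply] at chernoff
  refine chernoff.trans ((mul_le_mul_of_nonneg_left hmgf (Real.exp_pos _).le).trans_eq ?_)
  rw [← Real.exp_nat_mul, ← Real.exp_add]
  ring_nf

theorem sqrt_two_le_exp : √2 ≤ Real.exp (3 / 8) := by
  rw [Real.sqrt_le_left (Real.exp_pos _).le, ← Real.exp_nat_mul,
    ← Real.log_le_iff_le_exp zero_lt_two]
  norm_num
  linarith [Real.log_two_lt_d9]

theorem measureReal_le_sum_sq_le_exp (hind : iIndepFun X P)
    (hsub : ∀ i, HasSubgaussianMGF (X i) 2 P) :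
    P.real {ω | 4 * Fintype.card κ ≤ ∑ i, X i ω ^ 2} ≤ Real.exp (-(Fintype.card κ / 8)) := by
  have := hind.isProbabilityMeasure
  have hmeas (i : κ) : AEMeasurable (fun ω ↦ X i ω ^ 2) P := (hsub i).aemeasurable.pow_const 2
  have hind_sq : iIndepFun (fun i ω ↦ X i ω ^ 2) P :=
    hind.comp (fun _ x ↦ x ^ 2) fun _ ↦ by fun_prop
  have ht : ((2 : NNReal) : ℝ) * (1 / 2) ^ 2 < 1 := by norm_num
  have hmgf := mgf_sum_le_pow hind_sq hmeas fun i ↦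
    (mgf_sq_le_of_hasSubgaussianMGF (hsub i) ht).trans
      (le_of_eq_of_le (by norm_num) sqrt_two_le_exp)
  have hint : Integrable (fun ω ↦ Real.exp ((1 / 2) ^ 2 / 2 * (∑ i, fun ω ↦ X i ω ^ 2) ω)) P := by
    rw [← mgf_pos_iff, hind_sq.mgf_sum₀ hmeas]
    exact Finset.prod_pos fun i _ ↦ mgf_pos (integrable_exp_sq_of_hasSubgaussianMGF (hsub i) ht)
  have chernoff := measure_ge_le_exp_mul_mgf (μ := P) (4 * Fintype.card κ : ℝ) (by norm_num) hint
  simp only [Finset.sum_apply] at chernoff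
  refine chernoff.trans ((mul_le_mul_of_nonneg_left hmgf (Real.exp_pos _).le).trans_eq ?_)
  rw [← Real.exp_nat_mul, ← Real.exp_add]
  ring_nf

end SumOfSquares

section RandomVector

variable {Ω Ω' : Type*} [MeasurableSpace Ω] [MeasurableSpace Ω'] {P : Measure Ω} {P' : Measure Ω'}
  {n : ℕ} {X Y : Ω → EuclideanSpace ℝ (Fin n)} {X' : Ω' → EuclideanSpace ℝ (Fin n)}

theorem oneSubgaussian_iff : OneSubgaussian X P ↔ ∀ v : EuclideanSpace ℝ (Fin n), ‖v‖ ≤ 1 →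
    HasSubgaussianMGF (fun ω ↦ inner ℝ (X ω) v) 2 P := by
  have variance_proxy (t : ℝ) : ((2 : NNReal) : ℝ) * t ^ 2 / 2 = t ^ 2 := by simp
  refine forall_congr' fun v ↦ ?_
  rw [sq_le_one_iff₀ (norm_nonneg v)]
  refine imp_congr_right fun _ ↦ ⟨fun h ↦ ⟨fun t ↦ (h t).1, fun t ↦ ?_⟩, fun h t ↦
    ⟨h.integrable_exp_mul t, ?_⟩⟩
  · exact (h t).2.trans_eq (by rw [variance_proxy])
  · exact (h.mgf_le t).trans_eq (by rw [variance_proxy])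

theorem OneSubgaussian.aemeasurable (h : OneSubgaussian X P) : AEMeasurable X P := by
  have coord (j : Fin n) : AEMeasurable (fun ω ↦ X ω j) P := by
    simpa [EuclideanSpace.inner_single_right] using
      (oneSubgaussian_iff.1 h (EuclideanSpace.single j 1) (by simp)).aemeasurable
  exact (WithLp.measurable_toLp 2 _).comp_aemeasurable (aemeasurable_pi_lambda _ coord)

theorem OneSubgaussian.integral_inner_eq_zero [IsProbabilityMeasure P] (h : OneSubgaussian X P)
    (v : EuclideanSpace ℝ (Fin n)) : ∫ ω, inner ℝ (X ω) v ∂P = 0 := by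
  have hv := integral_eq_zero_of_hasSubgaussianMGF
    (oneSubgaussian_iff.1 h (‖v‖⁻¹ • v) (by simpa [norm_smul] using inv_mul_le_one))
  rcases eq_or_ne v 0 with rfl | hv0
  · simp
  · simpa [inner_smul_right, integral_const_mul, hv0] using hv

theorem OneSubgaussian.congr_identDistrib (h : OneSubgaussian X P) (hXX' : IdentDistrib X X' P P') :
    OneSubgaussian X' P' :=
  oneSubgaussian_iff.2 fun v hv ↦ (oneSubgaussian_iff.1 h v hv).congr_identDistrib
    (hXX'.comp (u := fun x ↦ inner ℝ x v) (by fun_prop))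

theorem SubIsotropic.congr_identDistrib (h : SubIsotropic X P) (hXX' : IdentDistrib X X' P P') :
    SubIsotropic X' P' := fun v ↦ by
  have hsq := hXX'.comp (u := fun x ↦ inner ℝ x v ^ 2) (by fun_prop)
  exact ⟨hsq.integrable_iff.1 (h v).1, (h v).2.trans_eq hsq.integral_eq⟩

theorem inv_sqrt_two_sq : (√2)⁻¹ ^ 2 = (1 / 2 : ℝ) := by
  rw [inv_pow, Real.sq_sqrt zero_le_two, one_div]

theorem OneSubgaussian.normalized_sub (hX : OneSubgaussian X P) (hY : OneSubgaussian Y P)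
    (hXY : IndepFun X Y P) : OneSubgaussian (fun ω ↦ (√2)⁻¹ • (X ω - Y ω)) P := by
  refine oneSubgaussian_iff.2 fun v hv ↦ ?_
  have hind : IndepFun (fun ω ↦ inner ℝ (X ω) v) (fun ω ↦ inner ℝ (Y ω) v) P :=
    hXY.comp (φ := fun x ↦ inner ℝ x v) (ψ := fun x ↦ inner ℝ x v) (by fun_prop) (by fun_prop)
  have h := ((oneSubgaussian_iff.1 hX v hv).sub_of_indepFun
    (oneSubgaussian_iff.1 hY v hv) hind).const_mul (√2)⁻¹
  simp_rw [real_inner_smul_left, inner_sub_left]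
  convert h using 1
  refine NNReal.eq ?_
  change (2 : ℝ) = (√2)⁻¹ ^ 2 * (2 + 2)
  norm_num [inv_sqrt_two_sq]

theorem SubIsotropic.normalized_sub [IsProbabilityMeasure P] (hX : SubIsotropic X P)
    (hY : SubIsotropic Y P) (hX_sub : OneSubgaussian X P) (hY_meas : AEMeasurable Y P)
    (hXY : IndepFun X Y P) : SubIsotropic (fun ω ↦ (√2)⁻¹ • (X ω - Y ω)) P := fun v ↦ by
  have hX_meas := hX_sub.aemeasurable
  have hX_memLp : MemLp (fun ω ↦ inner ℝ (X ω) v) 2 P :=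
    (memLp_two_iff_integrable_sq (by fun_prop)).2 (hX v).1
  have hY_memLp : MemLp (fun ω ↦ inner ℝ (Y ω) v) 2 P :=
    (memLp_two_iff_integrable_sq (by fun_prop)).2 (hY v).1
  have hind : IndepFun (fun ω ↦ inner ℝ (X ω) v) (fun ω ↦ inner ℝ (Y ω) v) P :=
    hXY.comp (φ := fun x ↦ inner ℝ x v) (ψ := fun x ↦ inner ℝ x v) (by fun_prop) (by fun_prop)
  have cross_int : Integrable (fun ω ↦ inner ℝ (X ω) v * inner ℝ (Y ω) v) P :=
    hX_memLp.integrable_mul hY_memLp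
  have cross_zero : ∫ ω, inner ℝ (X ω) v * inner ℝ (Y ω) v ∂P = 0 := by
    rw [hind.integral_fun_mul_eq_mul_integral (by fun_prop) (by fun_prop),
      hX_sub.integral_inner_eq_zero, zero_mul]
  have squares_int : Integrable (fun ω ↦ 1 / 2 * (inner ℝ (X ω) v ^ 2 + inner ℝ (Y ω) v ^ 2)) P :=
    ((hX v).1.add (hY v).1).const_mul _
  have expand : (fun ω ↦ inner ℝ ((√2)⁻¹ • (X ω - Y ω)) v ^ 2) = fun ω ↦
      1 / 2 * (inner ℝ (X ω) v ^ 2 + inner ℝ (Y ω) v ^ 2) - inner ℝ (X ω) v * inner ℝ (Y ω) v := by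
    ext ω
    rw [real_inner_smul_left, inner_sub_left, mul_pow, inv_sqrt_two_sq]
    ring
  rw [expand]
  refine ⟨squares_int.sub cross_int, ?_⟩
  rw [integral_sub squares_int cross_int, integral_const_mul, integral_add (hX v).1 (hY v).1,
    cross_zero]
  linarith [(hX v).2, (hY v).2]

end RandomVector

section RandomRows

/-- The linear map `v ↦ (⟨d i, v⟩)_i`, that is, the matrix with rows `d i`, acting between
Euclidean spaces. -/
noncomputable def rowMap {κ E : Type*} [NormedAddCommGroup E] [InnerProductSpace ℝ E]
    (d : κ → E) : E →ₗ[ℝ] EuclideanSpace ℝ κ :=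
  (WithLp.linearEquiv 2 ℝ (κ → ℝ)).symm.toLinearMap ∘ₗ LinearMap.pi fun i ↦ innerₗ E (d i)

theorem norm_rowMap_sq {κ E : Type*} [Fintype κ] [NormedAddCommGroup E] [InnerProductSpace ℝ E]
    (d : κ → E) (v : E) : ‖rowMap d v‖ ^ 2 = ∑ i, inner ℝ (d i) v ^ 2 := by
  simp [EuclideanSpace.norm_sq_eq, rowMap]

variable {Ω κ : Type*} [MeasurableSpace Ω] {P : Measure Ω} {n k : ℕ}
  {d : κ → Ω → EuclideanSpace ℝ (Fin n)}

theorem iIndepFun_inner (hd : iIndepFun d P) (v : EuclideanSpace ℝ (Fin n)) :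
    iIndepFun (fun i ω ↦ inner ℝ (d i ω) v) P :=
  hd.comp (fun _ x ↦ inner ℝ x v) fun _ ↦ by fun_prop

variable [Fintype κ]

theorem measureReal_norm_rowMap_lt_le_exp (hd : iIndepFun d P) (hiso : ∀ i, SubIsotropic (d i) P)
    (hsub : ∀ i, OneSubgaussian (d i) P) (y : EuclideanSpace ℝ (Fin n)) :
    P.real {ω | ‖rowMap (d · ω) y‖ < √(Fintype.card κ) / 5 * ‖y‖}
      ≤ Real.exp (-(Fintype.card κ / 25)) := by
  have := hd.isProbabilityMeasure
  rcases eq_or_ne y 0 with rfl | hy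
  · simpa using (Real.exp_pos _).le
  have hy' := norm_pos_iff.2 hy
  set u := ‖y‖⁻¹ • y with hu_def
  have hu : ‖u‖ = 1 := by simp [hu_def, norm_smul, hy]
  refine (measureReal_mono ?_).trans (measureReal_sum_sq_le_le_exp
    (iIndepFun_inner hd u) (fun i ↦ oneSubgaussian_iff.1 (hsub i) u hu.le)
    fun i ↦ by simpa [hu] using (hiso i u).2)
  intro ω hω
  simp only [Set.mem_ofPred_eq] at hω ⊢
  have unit_lt : ‖rowMap (d · ω) u‖ < √(Fintype.card κ) / 5 := by
    rwa [hu_def, map_smul, norm_smul, norm_inv, norm_norm, inv_mul_lt_iff₀' hy']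
  rw [← norm_rowMap_sq (d · ω)]
  calc ‖rowMap (d · ω) u‖ ^ (2 : ℕ) ≤ (√(Fintype.card κ) / 5) ^ 2 := by gcongr
    _ = (Fintype.card κ : ℝ) / 25 := by
      rw [div_pow, Real.sq_sqrt (Nat.cast_nonneg _)]
      norm_num

theorem measureReal_lt_norm_rowMap_single_sq_le_exp (hd : iIndepFun d P)
    (hsub : ∀ i, OneSubgaussian (d i) P) (j : Fin n) :
    P.real {ω | 4 * Fintype.card κ < ‖rowMap (d · ω) (EuclideanSpace.single j 1)‖ ^ 2}
      ≤ Real.exp (-(Fintype.card κ / 8)) := by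
  have := hd.isProbabilityMeasure
  refine (measureReal_mono ?_).trans (measureReal_le_sum_sq_le_exp (iIndepFun_inner hd
    (EuclideanSpace.single j 1)) fun i ↦ oneSubgaussian_iff.1 (hsub i) _ (by simp))
  intro ω hω
  rw [Set.mem_ofPred_eq, norm_rowMap_sq] at hω
  exact hω.le

theorem measureReal_exists_norm_rowMap_add_lt_le (hk : 0 < k) (hd : iIndepFun d P)
    (hiso : ∀ i, SubIsotropic (d i) P) (hsub : ∀ i, OneSubgaussian (d i) P) :
    P.real {ω | ∃ v : EuclideanSpace ℝ (Fin n),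
        ‖rowMap (d · ω) v‖ + 3 * √(Fintype.card κ / k) * ∑ j, |v j|
          < √(Fintype.card κ) / 5 * ‖v‖}
      ≤ (Fintype.card (Sym (Fin n ⊕ Fin n) k) + n) * Real.exp (-(Fintype.card κ / 25)) := by
  have := hd.isProbabilityMeasure
  set M : ℝ := (Fintype.card κ : ℝ)
  have hM0 : 0 ≤ M := Nat.cast_nonneg _
  let netFails (σ : Sym (Fin n ⊕ Fin n) k) : Set Ω :=
    {ω | ‖rowMap (d · ω) (symSum signedBasis σ)‖ < √M / 5 * ‖symSum signedBasis σ‖}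
  let colFails (j : Fin n) : Set Ω :=
    {ω | 4 * M < ‖rowMap (d · ω) (EuclideanSpace.single j 1)‖ ^ 2}
  have cover : {ω | ∃ v : EuclideanSpace ℝ (Fin n),
      ‖rowMap (d · ω) v‖ + 3 * √(M / k) * ∑ j, |v j| < √M / 5 * ‖v‖}
        ⊆ (⋃ σ, netFails σ) ∪ ⋃ j, colFails j := by
    rintro ω ⟨v, hv⟩
    by_contra hω
    simp only [Set.mem_union, Set.mem_iUnion, not_or, not_exists, netFails, colFails,
      Set.mem_ofPred_eq, not_lt] at hω
    have error_le : √(2 * ((√M / 5) ^ 2 + 4 * M) / k) ≤ 3 * √(M / k) := by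
      rw [div_pow, Real.sq_sqrt hM0, show (3 : ℝ) = √(3 ^ 2) by simp, ← Real.sqrt_mul (by simp),
        ← mul_div_assoc]
      refine Real.sqrt_le_sqrt (div_le_div_of_nonneg_right ?_ (Nat.cast_nonneg k))
      linarith
    have lower := le_norm_map_add_of_forall_sym hk (by positivity) hω.2 hω.1 v
    refine absurd hv (not_lt.2 (lower.trans ?_))
    gcongr
  refine (measureReal_mono cover).trans ((measureReal_union_le _ _).trans ?_)
  rw [add_mul]
  refine add_le_add ((measureReal_iUnion_fintype_le _).trans ?_)
    ((measureReal_iUnion_fintype_le _).trans ?_)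
  · refine (Finset.sum_le_card_nsmul _ _ (Real.exp (-(M / 25))) fun σ _ ↦
      measureReal_norm_rowMap_lt_le_exp hd hiso hsub (symSum signedBasis σ)).trans_eq ?_
    rw [Finset.card_univ, nsmul_eq_mul]
  · have col (j : Fin n) : P.real (colFails j) ≤ Real.exp (-(M / 25)) :=
      (measureReal_lt_norm_rowMap_single_sq_le_exp hd hsub j).trans (by gcongr; norm_num)
    refine (Finset.sum_le_card_nsmul _ _ _ fun j _ ↦ col j).trans_eq ?_
    rw [Finset.card_univ, Fintype.card_fin, nsmul_eq_mul]

end RandomRows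

section Cone

variable {n s k : ℕ}

theorem log_exp_one_mul_div (hs : 0 < s) (hsn : s ≤ n) :
    Real.log (Real.exp 1 * n / s) = 1 + Real.log (n / s) := by
  have hn : 0 < n := hs.trans_le hsn
  rw [mul_div_assoc, Real.log_mul (Real.exp_pos 1).ne' (by positivity), Real.log_exp]

theorem log_div_nonneg (hs : 0 < s) (hsn : s ≤ n) : 0 ≤ Real.log (n / s) :=
  Real.log_nonneg ((one_le_div (by positivity)).2 (mod_cast hsn))

theorem card_sym_sum_le_exp (hs : 0 < s) (hsn : s ≤ n) (hsk : s ≤ k) :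
    (Fintype.card (Sym (Fin n ⊕ Fin n) k) : ℝ)
      ≤ Real.exp (k * (2 + Real.log (Real.exp 1 * n / s))) := by
  have hn : 0 < n := hs.trans_le hsn
  have hk : 0 < k := hs.trans_le hsk
  refine (card_sym_le_exp hk).trans (Real.exp_le_exp.2 ?_)
  have ratio_le : (n + n + k : ℝ) / k ≤ 3 * (n / s) := by
    have n_le : (n : ℝ) / k ≤ n / s := by gcongr
    have one_le : (1 : ℝ) ≤ n / s := (one_le_div (by positivity)).2 (mod_cast hsn)
    rw [add_div, add_div, div_self (by positivity)]
    linarith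
  have log_le : Real.log ((n + n + k : ℝ) / k) ≤ 2 + Real.log (n / s) := by
    calc Real.log ((n + n + k : ℝ) / k) ≤ Real.log (3 * (n / s)) := by gcongr
      _ = Real.log 3 + Real.log (n / s) := Real.log_mul three_ne_zero (by positivity)
      _ ≤ 2 + Real.log (n / s) := by
        linarith [Real.log_le_sub_one_of_pos (zero_lt_three (α := ℝ))]
  rw [Fintype.card_sum, Fintype.card_fin, Nat.cast_add, log_exp_one_mul_div hs hsn]
  exact mul_le_mul_of_nonneg_left (by linarith) k.cast_nonneg

theorem natCast_le_exp_mul_log (hs : 0 < s) (hsn : s ≤ n) (hsk : s ≤ k) :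
    (n : ℝ) ≤ Real.exp (k * (2 + Real.log (Real.exp 1 * n / s))) := by
  have hn : 0 < n := hs.trans_le hsn
  have hs' : (1 : ℝ) ≤ s := mod_cast hs
  have hsk' : (s : ℝ) ≤ k := mod_cast hsk
  have hlog := log_div_nonneg hs hsn
  calc (n : ℝ) = s * Real.exp (Real.log (n / s)) := by
        rw [Real.exp_log (by positivity), mul_div_cancel₀ _ (by positivity)]
    _ ≤ Real.exp s * Real.exp (Real.log (n / s)) := by
        gcongr
        linarith [Real.add_one_le_exp (s : ℝ)]
    _ = Real.exp (s + Real.log (n / s)) := (Real.exp_add _ _).symm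
    _ ≤ Real.exp (k * (2 + Real.log (Real.exp 1 * n / s))) := by
        rw [log_exp_one_mul_div hs hsn]
        gcongr
        nlinarith

theorem card_sym_add_mul_exp_le (hs : 0 < s) (hsn : s ≤ n) {L M : ℝ} (hsL : s ≤ L ^ 2)
    (hLk : L ^ 2 ≤ k) (hkL : k ≤ 1025 * L ^ 2)
    (hM : 384 ^ 2 * L ^ 2 * (2 + √(Real.log (Real.exp 1 * n / s))) ^ 2 ≤ M) :
    (Fintype.card (Sym (Fin n ⊕ Fin n) k) + n) * Real.exp (-(M / 25)) ≤ Real.exp (-(M / 32)) := by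
  have hs' : (1 : ℝ) ≤ s := mod_cast hs
  have hsk : s ≤ k := by exact_mod_cast hsL.trans hLk
  set l := Real.log (Real.exp 1 * n / s)
  have hl0 : 0 ≤ l := by linarith [log_exp_one_mul_div hs hsn, log_div_nonneg hs hsn]
  have entropy_le_sq : 4 + l ≤ (2 + √l) ^ 2 := by
    nlinarith [Real.sq_sqrt hl0, Real.sqrt_nonneg l]
  have entropy_le : 384 ^ 2 * L ^ 2 * (4 + l) ≤ M := le_trans (by gcongr) hM
  have exponent_le : k * (2 + l) ≤ M / 125 := by
    calc k * (2 + l) ≤ 1025 * L ^ 2 * (4 + l) := by gcongr; norm_num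
      _ ≤ M / 125 := by nlinarith [mul_nonneg (sq_nonneg L) hl0]
  have M_large : 4 * 384 ^ 2 ≤ M := by nlinarith
  have hexp : Real.exp (k * (2 + l)) ≤ Real.exp (M / 125) := Real.exp_le_exp.2 exponent_le
  calc (Fintype.card (Sym (Fin n ⊕ Fin n) k) + n) * Real.exp (-(M / 25))
      ≤ (Real.exp (M / 125) + Real.exp (M / 125)) * Real.exp (-(M / 25)) := by
        gcongr
        exacts [(card_sym_sum_le_exp hs hsn hsk).trans hexp,
          (natCast_le_exp_mul_log hs hsn hsk).trans hexp]
    _ = 2 * Real.exp (M / 125 - M / 25) := by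
        rw [← two_mul, mul_assoc, ← Real.exp_add, sub_eq_add_neg]
    _ ≤ Real.exp 1 * Real.exp (M / 125 - M / 25) := by
        gcongr
        linarith [Real.add_one_le_exp (1 : ℝ)]
    _ ≤ Real.exp (-(M / 32)) := by
        rw [← Real.exp_add]
        gcongr
        linarith

theorem measureReal_exists_sum_abs_le_and_norm_rowMap_lt_le_exp {Ω κ : Type*} [MeasurableSpace Ω]
    {P : Measure Ω} [Fintype κ] {d : κ → Ω → EuclideanSpace ℝ (Fin n)} (hs : 0 < s) (hsn : s ≤ n)
    (hd : iIndepFun d P) (hiso : ∀ i, SubIsotropic (d i) P) (hsub : ∀ i, OneSubgaussian (d i) P)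
    {L : ℝ} (hL : 0 < L) (hsL : s ≤ L ^ 2)
    (hM : 384 ^ 2 * L ^ 2 * (2 + √(Real.log (Real.exp 1 * n / s))) ^ 2 ≤ Fintype.card κ) :
    P.real {ω | ∃ v : EuclideanSpace ℝ (Fin n), ∑ j, |v j| ≤ 2 * L * ‖v‖ ∧
        80 * ‖rowMap (d · ω) v‖ < √(Fintype.card κ) * ‖v‖}
      ≤ Real.exp (-(Fintype.card κ / 32)) := by
  have := hd.isProbabilityMeasure
  set M : ℝ := (Fintype.card κ : ℝ)
  have hs' : (1 : ℝ) ≤ s := mod_cast hs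
  set k := ⌈(32 * L) ^ 2⌉₊
  have le_k : (32 * L) ^ 2 ≤ k := Nat.le_ceil _
  have k_le : (k : ℝ) ≤ 1025 * L ^ 2 := by
    linarith [Nat.ceil_lt_add_one (sq_nonneg (32 * L)), mul_pow 32 L 2]
  have hk : 0 < k := Nat.ceil_pos.2 (by positivity)
  refine (measureReal_mono ?_).trans
    ((measureReal_exists_norm_rowMap_add_lt_le hk hd hiso hsub).trans
      (card_sym_add_mul_exp_le hs hsn hsL (by nlinarith) k_le hM))
  rintro ω ⟨v, hv, hlt⟩
  refine ⟨v, ?_⟩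
  have error_le : 3 * √(M / k) * ∑ j, |v j| ≤ 6 / 32 * (√M * ‖v‖) := by
    calc 3 * √(M / k) * ∑ j, |v j| ≤ 3 * √(M / (32 * L) ^ 2) * (2 * L * ‖v‖) := by gcongr
      _ = 6 / 32 * (√M * ‖v‖) := by
        rw [Real.sqrt_div' _ (sq_nonneg _), Real.sqrt_sq (by positivity)]
        field_simp
        ring
  linarith

end Cone

section LqNorm

variable {ι : Type*} [Fintype ι] {p q : ℝ}

theorem lqNorm_nonneg (q : ℝ) (x : ι → ℝ) : 0 ≤ lqNorm q x :=
  Real.rpow_nonneg (Finset.sum_nonneg fun _ _ ↦ Real.rpow_nonneg (abs_nonneg _) q) _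

theorem lqNorm_one (x : ι → ℝ) : lqNorm 1 x = ∑ i, |x i| := by
  simp [lqNorm]

theorem lqNorm_two (x : ι → ℝ) : lqNorm 2 x = ‖WithLp.toLp 2 x‖ := by
  simp [lqNorm, EuclideanSpace.norm_eq, Real.sqrt_eq_rpow]

theorem lqNorm_rpow (hq : q ≠ 0) (x : ι → ℝ) : lqNorm q x ^ q = ∑ i, |x i| ^ q := by
  rw [lqNorm, one_div, Real.rpow_inv_rpow (by positivity) hq]

theorem abs_le_lqNorm (hq : 0 < q) (x : ι → ℝ) (i : ι) : |x i| ≤ lqNorm q x := by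
  rw [← Real.rpow_le_rpow_iff (abs_nonneg _) (lqNorm_nonneg q x) hq, lqNorm_rpow hq.ne']
  exact Finset.single_le_sum (f := fun i ↦ |x i| ^ q) (fun j _ ↦ by positivity) (Finset.mem_univ i)

theorem lqNorm_anti (hp : 0 < p) (hpq : p ≤ q) (x : ι → ℝ) : lqNorm q x ≤ lqNorm p x := by
  have hq : 0 < q := hp.trans_le hpq
  have rpow_split {t : ℝ} (ht : 0 ≤ t) : t ^ q = t ^ (q - p) * t ^ p := by
    rw [← Real.rpow_add' ht (by simpa using hq.ne'), sub_add_cancel]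
  rw [← Real.rpow_le_rpow_iff (lqNorm_nonneg q x) (lqNorm_nonneg p x) hq, lqNorm_rpow hq.ne',
    rpow_split (lqNorm_nonneg p x), lqNorm_rpow hp.ne', Finset.mul_sum]
  refine Finset.sum_le_sum fun i _ ↦ ?_
  rw [rpow_split (abs_nonneg _)]
  gcongr
  exact abs_le_lqNorm hp x i

theorem lqNorm_indicator_le (hq : 0 ≤ q) (S : Set ι) (x : ι → ℝ) :
    lqNorm q (S.indicator x) ≤ lqNorm q x := by
  refine Real.rpow_le_rpow (by positivity) (Finset.sum_le_sum fun i _ ↦ ?_) (by positivity)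
  exact Real.rpow_le_rpow (abs_nonneg _) (norm_indicator_le_norm_self x i) hq

theorem lqNorm_one_indicator_add_compl (S : Set ι) (x : ι → ℝ) :
    lqNorm 1 (S.indicator x) + lqNorm 1 (Sᶜ.indicator x) = lqNorm 1 x := by
  simp_rw [lqNorm_one, ← Finset.sum_add_distrib]
  refine Finset.sum_congr rfl fun i _ ↦ ?_
  by_cases hi : i ∈ S <;> simp [hi]

theorem lqNorm_one_indicator_le (S : Finset ι) (x : ι → ℝ) :
    lqNorm 1 ((S : Set ι).indicator x) ≤ √S.card * lqNorm 2 x := by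
  have sum_eq : lqNorm 1 ((S : Set ι).indicator x) = ∑ i ∈ S, |x i| := by
    rw [lqNorm_one, ← Finset.sum_indicator_subset _ (Finset.subset_univ S)]
    refine Finset.sum_congr rfl fun i _ ↦ ?_
    by_cases hi : i ∈ S <;> simp [hi]
  rw [sum_eq, lqNorm_two, EuclideanSpace.norm_eq, ← Real.sqrt_mul (Nat.cast_nonneg _)]
  refine Real.le_sqrt_of_sq_le (sq_sum_le_card_mul_sum_sq.trans ?_)
  gcongr
  exact Finset.sum_le_univ_sum_of_nonneg fun i ↦ sq_nonneg _

end LqNorm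

section NullSpaceProperty

variable {m n s : ℕ} {q ρ τ : ℝ}

/-- Half of the bound on `‖v‖₁ / ‖v‖₂` which cuts out the cone of vectors that can violate the
robust null space property of order `s` with respect to the `ℓ_q` norm and with parameter `ρ`. -/
noncomputable def coneRadius (s : ℕ) (q ρ : ℝ) : ℝ :=
  (s : ℝ) ^ (1 - 1 / q) / ρ

theorem coneRadius_pos (hs : 0 < s) (hρ0 : 0 < ρ) : 0 < coneRadius s q ρ := by
  unfold coneRadius
  positivity

theorem coneRadius_sq (s : ℕ) (q ρ : ℝ) :
    coneRadius s q ρ ^ 2 = (s : ℝ) ^ (2 - 2 / q) / ρ ^ 2 := by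
  rw [coneRadius, div_pow, ← Real.rpow_mul_natCast (Nat.cast_nonneg s)]
  ring_nf

theorem natCast_le_coneRadius_sq (hs : 0 < s) (hq : 2 ≤ q) (hρ0 : 0 < ρ) (hρ1 : ρ ≤ 1) :
    s ≤ coneRadius s q ρ ^ 2 := by
  have hexp : 1 ≤ 2 - 2 / q := by linarith [(div_le_one (by linarith)).2 hq]
  rw [coneRadius_sq]
  exact (Real.self_le_rpow_of_one_le (mod_cast hs) hexp).trans
    (le_div_self (by positivity) (by positivity) (pow_le_one₀ hρ0.le hρ1))

theorem lqNorm_one_le_of_lqNorm_one_compl_le (hq : 2 ≤ q) {L : ℝ} (hL : 0 ≤ L) (hsL : s ≤ L ^ 2)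
    {v : Fin n → ℝ} {S : Finset (Fin n)} (hS : S.card ≤ s)
    (hv : lqNorm 1 ((S : Set (Fin n))ᶜ.indicator v)
      ≤ L * lqNorm q ((S : Set (Fin n)).indicator v)) :
    lqNorm 1 v ≤ 2 * L * lqNorm 2 v := by
  have head_le : lqNorm 1 ((S : Set (Fin n)).indicator v) ≤ L * lqNorm 2 v := by
    refine (lqNorm_one_indicator_le S v).trans ?_
    gcongr
    · exact lqNorm_nonneg 2 v
    · exact (Real.sqrt_le_left hL).2 (le_trans (mod_cast hS) hsL)
  have tail_le : lqNorm 1 ((S : Set (Fin n))ᶜ.indicator v) ≤ L * lqNorm 2 v := by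
    refine hv.trans (mul_le_mul_of_nonneg_left ?_ hL)
    exact (lqNorm_anti zero_lt_two hq _).trans (lqNorm_indicator_le zero_le_two _ v)
  linarith [lqNorm_one_indicator_add_compl (S : Set (Fin n)) v]

theorem robustNSP_of_forall_lqNorm_two_le (hs : 0 < s) (hq : 2 ≤ q) (hρ0 : 0 < ρ) (hρ1 : ρ ≤ 1)
    (hτ : 0 ≤ τ) {A : Matrix (Fin m) (Fin n) ℝ}
    (h : ∀ v, lqNorm 1 v ≤ 2 * coneRadius s q ρ * lqNorm 2 v →
      lqNorm 2 v ≤ τ * lqNorm 2 (A.mulVec v)) :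
    RobustNSP q s ρ τ A := by
  intro v S hS
  have hL := coneRadius_pos (q := q) hs hρ0
  have tail_nonneg := lqNorm_nonneg 1 ((S : Set (Fin n))ᶜ.indicator v)
  rw [← inv_div, ← coneRadius]
  rcases le_total (lqNorm 1 ((S : Set (Fin n))ᶜ.indicator v))
    (coneRadius s q ρ * lqNorm q ((S : Set (Fin n)).indicator v)) with hcone | hcone
  · calc lqNorm q ((S : Set (Fin n)).indicator v) ≤ lqNorm 2 v :=
        (lqNorm_anti zero_lt_two hq _).trans (lqNorm_indicator_le zero_le_two _ v)
      _ ≤ τ * lqNorm 2 (A.mulVec v) := h v (lqNorm_one_le_of_lqNorm_one_compl_le hq hL.le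
        (natCast_le_coneRadius_sq hs hq hρ0 hρ1) hS hcone)
      _ ≤ _ := le_add_of_nonneg_left (by positivity)
  · exact ((le_inv_mul_iff₀ hL).2 hcone).trans
      (le_add_of_nonneg_right (mul_nonneg hτ (lqNorm_nonneg _ _)))

end NullSpaceProperty

section PairDiff

variable {ι κ E : Type*} [NormedAddCommGroup E] [InnerProductSpace ℝ E]

/-- The differences, normalized by `√2`, of the pairs of rows of `a` selected by `e`; a bias common
to all rows drops out of them. -/
noncomputable def pairDiff (e : κ × Fin 2 ↪ ι) (a : ι → E) (i : κ) : E :=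
  (√2)⁻¹ • (a (e (i, 0)) - a (e (i, 1)))

theorem pairDiff_add_const (e : κ × Fin 2 ↪ ι) (a : ι → E) (b : E) :
    pairDiff e (fun i ↦ a i + b) = pairDiff e a := by
  ext1 i
  simp only [pairDiff, add_sub_add_right_eq_sub]

theorem norm_rowMap_pairDiff_le [Fintype κ] [Fintype ι] (e : κ × Fin 2 ↪ ι) (a : ι → E) (v : E) :
    ‖rowMap (pairDiff e a) v‖ ≤ ‖rowMap a v‖ := by
  refine le_of_sq_le_sq ?_ (norm_nonneg _)
  rw [norm_rowMap_sq, norm_rowMap_sq]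
  calc ∑ i, inner ℝ (pairDiff e a i) v ^ 2
      ≤ ∑ i, ∑ j : Fin 2, inner ℝ (a (e (i, j))) v ^ 2 := by
        refine Finset.sum_le_sum fun i _ ↦ ?_
        rw [pairDiff, real_inner_smul_left, inner_sub_left, mul_pow, inv_sqrt_two_sq,
          Fin.sum_univ_two]
        nlinarith [sq_nonneg (inner ℝ (a (e (i, 0))) v + inner ℝ (a (e (i, 1))) v)]
    _ = ∑ j ∈ Finset.univ.map e, inner ℝ (a j) v ^ 2 := by
        rw [Finset.sum_map, Fintype.sum_prod_type]
    _ ≤ ∑ j, inner ℝ (a j) v ^ 2 := Finset.sum_le_univ_sum_of_nonneg fun j ↦ sq_nonneg _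

theorem lqNorm_two_mulVec {m n : ℕ} (A : Matrix (Fin m) (Fin n) ℝ) (v : Fin n → ℝ) :
    lqNorm 2 (A.mulVec v) = ‖rowMap (fun i ↦ WithLp.toLp 2 (A i)) (WithLp.toLp 2 v)‖ := by
  rw [lqNorm_two]
  congr 1
  ext i
  simp [rowMap, Matrix.mulVec, dotProduct, PiLp.inner_apply, mul_comm]

theorem robustNSP_of_forall_le_norm_rowMap_pairDiff {m n s : ℕ} {q ρ τ : ℝ} [Fintype κ]
    (hs : 0 < s) (hq : 2 ≤ q) (hρ0 : 0 < ρ) (hρ1 : ρ ≤ 1) (hτ : 0 ≤ τ) (e : κ × Fin 2 ↪ Fin m)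
    {a : Fin m → EuclideanSpace ℝ (Fin n)}
    (h : ∀ v : EuclideanSpace ℝ (Fin n), ∑ j, |v j| ≤ 2 * coneRadius s q ρ * ‖v‖ →
      ‖v‖ ≤ τ * ‖rowMap (pairDiff e a) v‖) (b : Fin n → ℝ) :
    RobustNSP q s ρ τ (Matrix.of fun i j ↦ a i j + b j) := by
  refine robustNSP_of_forall_lqNorm_two_le hs hq hρ0 hρ1 hτ fun v hv ↦ ?_
  rw [lqNorm_two, lqNorm_one] at hv
  rw [lqNorm_two, lqNorm_two_mulVec]
  refine (h (WithLp.toLp 2 v) hv).trans (mul_le_mul_of_nonneg_left ?_ hτ)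
  rw [← pairDiff_add_const e a (WithLp.toLp 2 b)]
  exact norm_rowMap_pairDiff_le e _ _

end PairDiff

section RandomPairs

variable {Ω ι κ : Type*} [MeasurableSpace Ω] {P : Measure Ω}

theorem iIndepFun_curry {β : Type*} [MeasurableSpace β] [Countable ι] [Countable κ]
    {X : ι × κ → Ω → β} (hX : ∀ p, AEMeasurable (X p) P) (h : iIndepFun X P) :
    iIndepFun (fun i ω j ↦ X (i, j) ω) P := by
  have := h.isProbabilityMeasure
  have (p : ι × κ) : IsProbabilityMeasure (P.map (X p)) := Measure.isProbabilityMeasure_map (hX p)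
  have fiber_law (i : ι) :
      P.map (fun ω j ↦ X (i, j) ω) = Measure.infinitePi fun j ↦ P.map (X (i, j)) :=
    (h.precomp (Prod.mk_right_injective i)).map_fun_eq_infinitePi_map₀' fun j ↦ hX (i, j)
  rw [iIndepFun_iff_map_fun_eq_infinitePi_map₀'
    fun i ↦ aemeasurable_pi_lambda _ fun j ↦ hX (i, j)]
  simp_rw [fiber_law]
  rw [← Measure.infinitePi_map_curry fun i j ↦ P.map (X (i, j)),
    ← h.map_fun_eq_infinitePi_map₀' hX, AEMeasurable.map_map_of_aemeasurable
      (MeasurableEquiv.measurable _).aemeasurable (aemeasurable_pi_lambda _ hX)]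
  rfl

variable {n : ℕ} {a : ι → Ω → EuclideanSpace ℝ (Fin n)} (e : κ × Fin 2 ↪ ι)

theorem iIndepFun_pairDiff [Countable κ] (ha : ∀ i, AEMeasurable (a i) P) (h : iIndepFun a P) :
    iIndepFun (fun i ω ↦ pairDiff e (a · ω) i) P :=
  (iIndepFun_curry (fun p ↦ ha (e p)) (h.precomp e.injective)).comp
    (fun _ x ↦ (√2)⁻¹ • (x 0 - x 1)) fun _ ↦ by fun_prop

theorem indepFun_pair (h : iIndepFun a P) (i : κ) :
    IndepFun (a (e (i, 0))) (a (e (i, 1))) P :=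
  h.indepFun (e.injective.ne (by simp))

theorem oneSubgaussian_pairDiff (hsub : ∀ i, OneSubgaussian (a i) P) (h : iIndepFun a P) (i : κ) :
    OneSubgaussian (fun ω ↦ pairDiff e (a · ω) i) P :=
  (hsub _).normalized_sub (hsub _) (indepFun_pair e h i)

theorem subIsotropic_pairDiff (hiso : ∀ i, SubIsotropic (a i) P)
    (hsub : ∀ i, OneSubgaussian (a i) P) (h : iIndepFun a P) (i : κ) :
    SubIsotropic (fun ω ↦ pairDiff e (a · ω) i) P :=
  have := h.isProbabilityMeasure
  (hiso _).normalized_sub (hiso _) (hsub _) (hsub _).aemeasurable (indepFun_pair e h i)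

end RandomPairs

theorem one_sub_exp_le_measureReal_forall_bias_robustNSP {κ Ω : Type*} [Fintype κ] [Nonempty κ]
    [MeasurableSpace Ω] {P : Measure Ω} {m n s : ℕ} {q ρ : ℝ} (hs : 0 < s) (hsn : s ≤ n)
    (hq : 2 ≤ q) (hρ0 : 0 < ρ) (hρ1 : ρ ≤ 1) (e : κ × Fin 2 ↪ Fin m)
    (hκ : 384 ^ 2 * coneRadius s q ρ ^ 2 * (2 + √(Real.log (Real.exp 1 * n / s))) ^ 2
      ≤ Fintype.card κ)
    {a : Fin m → Ω → EuclideanSpace ℝ (Fin n)} (hiso : ∀ i, SubIsotropic (a i) P)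
    (hsub : ∀ i, OneSubgaussian (a i) P) (hind : iIndepFun a P) :
    1 - Real.exp (-(Fintype.card κ / 32)) ≤
      P.real {ω | ∀ b : Fin n → ℝ, RobustNSP q s ρ (80 / √(Fintype.card κ))
        (Matrix.of fun i j ↦ a i ω j + b j)} := by
  have := hind.isProbabilityMeasure
  have hfail := measureReal_exists_sum_abs_le_and_norm_rowMap_lt_le_exp hs hsn
    (iIndepFun_pairDiff e (fun i ↦ (hsub i).aemeasurable) hind)
    (subIsotropic_pairDiff e hiso hsub hind) (oneSubgaussian_pairDiff e hsub hind)
    (coneRadius_pos hs hρ0) (natCast_le_coneRadius_sq hs hq hρ0 hρ1) hκ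
  refine (sub_le_sub_left hfail 1).trans ?_
  rw [sub_le_iff_le_add, ← probReal_univ (μ := P)]
  refine (measureReal_mono fun ω _ ↦ ?_).trans (measureReal_union_le _ _)
  refine or_iff_not_imp_right.2 fun hω ↦ ?_
  refine robustNSP_of_forall_le_norm_rowMap_pairDiff hs hq hρ0 hρ1 (by positivity) e fun v hv ↦ ?_
  rw [div_mul_eq_mul_div, le_div_iff₀' (by positivity)]
  exact not_lt.1 fun hlt ↦ hω ⟨v, hv, hlt⟩

/-- The indices `2 * i` and `2 * i + 1`, for `i < m / 2`, as an embedding. -/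
def pairEmb (m : ℕ) : Fin (m / 2) × Fin 2 ↪ Fin m :=
  finProdFinEquiv.toEmbedding.trans (Fin.castLEEmb (Nat.div_mul_le_self m 2))

theorem corollary1_general (m n s : ℕ) (hs : 1 ≤ s) (hsn : s ≤ n) (q ρ : ℝ) (hq : 2 ≤ q)
    (hρ0 : 0 < ρ) (hρ1 : ρ ≤ 1)
    (hm : 2 * 384 ^ 2 / ρ ^ 2 * (s : ℝ) ^ (2 - 2 / q)
        * (2 + √(Real.log (Real.exp 1 * n / s))) ^ 2 + 1 ≤ m) :
    ∃ τ : ℝ, 0 < τ ∧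
      ∀ (Ω : Type*) [MeasurableSpace Ω] (P : Measure Ω)
        (a : Fin m → Ω → EuclideanSpace ℝ (Fin n)),
        (∀ i, SubIsotropic (a i) P) → (∀ i, OneSubgaussian (a i) P) → iIndepFun a P →
          1 - Real.exp (-((m : ℝ) - 1) / 64) ≤
            P.real {ω | ∀ b : Fin n → ℝ,
              RobustNSP q s ρ τ (Matrix.of fun i j ↦ a i ω j + b j)} := by
  have hm_half : (m : ℝ) ≤ 2 * (m / 2 : ℕ) + 1 := by norm_cast; omega
  have hL := coneRadius_pos (q := q) hs hρ0
  have hpairs : 384 ^ 2 * coneRadius s q ρ ^ 2 * (2 + √(Real.log (Real.exp 1 * n / s))) ^ 2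
      ≤ (m / 2 : ℕ) := by
    rw [coneRadius_sq]
    linear_combination (hm + hm_half) / 2
  have hpos : (0 : ℝ) < (m / 2 : ℕ) := lt_of_lt_of_le (by positivity) hpairs
  have : Nonempty (Fin (m / 2)) := Fin.pos_iff_nonempty.1 (mod_cast hpos)
  refine ⟨80 / √(m / 2 : ℕ), by positivity, fun Ω _ P a hiso hsub hind ↦ ?_⟩
  have hprob := one_sub_exp_le_measureReal_forall_bias_robustNSP hs hsn hq hρ0 hρ1 (pairEmb m)
    (by rwa [Fintype.card_fin]) hiso hsub hind
  rw [Fintype.card_fin] at hprob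
  refine le_trans ?_ hprob
  gcongr
  linarith

theorem corollary1 (m n s : ℕ) (hs : 1 ≤ s) (hsn : s ≤ n) (q ρ : ℝ) (hq : 2 ≤ q)
    (hρ0 : 0 < ρ) (hρ1 : ρ < 1)
    (hm : 2 * 384 ^ 2 / ρ ^ 2 * (s : ℝ) ^ (2 - 2 / q)
        * (2 + Real.sqrt (Real.log (Real.exp 1 * (n : ℝ) / (s : ℝ)))) ^ 2 + 1 ≤ (m : ℝ)) :
    ∃ τ : ℝ, 0 < τ ∧
      ∀ (Ω₀ : Type*) [MeasurableSpace Ω₀] (P₀ : Measure Ω₀) [IsProbabilityMeasure P₀]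
        (Ω : Type*) [MeasurableSpace Ω] (P : Measure Ω) [IsProbabilityMeasure P]
        (a₀ : Ω₀ → EuclideanSpace ℝ (Fin n)) (a : Fin m → Ω → EuclideanSpace ℝ (Fin n)),
        SubIsotropic a₀ P₀ → OneSubgaussian a₀ P₀ →
        (∀ i, IdentDistrib (a i) a₀ P P₀) → iIndepFun a P →
        ∀ μ : ℝ,
          1 - Real.exp (-((m : ℝ) - 1) / 64) ≤
            P.real {ω | RobustNSP q s ρ τ (biasedMatrix (fun i => a i ω) μ)} := by
  obtain ⟨τ, hτ, h⟩ := corollary1_general m n s hs hsn q ρ hq hρ0 hρ1.le hm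
  exact ⟨τ, hτ, fun Ω₀ _ P₀ _ Ω _ P _ a₀ a hiso hsub hid hind μ ↦
    (h Ω P a (fun i ↦ hiso.congr_identDistrib (hid i).symm)
      (fun i ↦ hsub.congr_identDistrib (hid i).symm) hind).trans
      (measureReal_mono fun ω hω ↦ hω fun _ ↦ μ)⟩
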